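/- A fuzzy graph $\Gamma=(V,\nu,\mu)$ on a finite vertex set $V$ consists of maps $\nu:V\to[0,1]$ and $\mu:V\times V\to[0,1]$, with $\mu$ symmetric, $\mu(v,v)=0$ and $\mu(u,v)\le\min\{\nu(u),\nu(v)\}$. Its underlying crisp graph has vertex set $V$ and edge set $E(\Gamma)=\{uv:\mu(uv)>0\}$. The fuzzy degree of $u$ is $\mu_u=\sum_{v}\mu(uv)$, the fuzzy size is $m_\mu=\sum_{uv\in E(\Gamma)}\mu(uv)$, and the fuzzy Sombor index is $$\mathrm{SO}^{\mu}(\Gamma)=\sum_{uv\in E(\Gamma)}\mu(uv)\sqrt{\mu_u^2+\mu_v^2}.$$ A fuzzy unicyclic graph is a fuzzy graph whose underlying crisp graph is connected and contains exactly one cycle. A triangle with a star attached is a graph consisting of a triangle with all remaining vertices (possibly none) joined to one and the same vertex of the triangle, and no further edges. **Theorem.** Let $n\ge 3$ and $0<m\le n$, and consider all fuzzy unicyclic graphs on a fixed set of $n$ vertices with fuzzy size $m_\mu=m$. (Minimum.) A fuzzy graph whose underlying graph is the cycle $C_n$ and whose edges all have membership $m/n$ exists, every such fuzzy graph is unicyclic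 of fuzzy size $m$, and it minimises $\mathrm{SO}^{\mu}$ in this class. Moreover, every minimiser has underlying graph $C_n$. (Maximum.) $\mathrm{SO}^{\mu}$ is maximised when the underlying graph is a cycle, namely a triangle, with a star attached, in the following sense: for every $\Gamma$ in the class there is a $\Gamma'$ in the class whose underlying graph is a triangle with a star attached and for which $\mathrm{SO}^{\mu}(\Gamma)\le\mathrm{SO}^{\mu}(\Gamma')$, where $\Gamma'$ can be chosen with strict inequality whenever the underlying graph of $\Gamma$ is not a triangle with a star attached. (So the supremum over the class equals the supremum over those members whose underlying graph is a triangle with a star attached, and any maximiser is of this kind.) A maximiser exists if and only if $m>n-1$. -/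

import Mathlib

/-- A fuzzy graph `(V, ν, μ)` without loops: `ν : V → [0,1]`, `μ : V × V → [0,1]` symmetric, and
`μ(u,v) ≤ min (ν u) (ν v)`. -/
structure FuzzyGraph (V : Type*) where
  ν : V → ℝ
  μ : V → V → ℝ
  ν_mem : ∀ v, ν v ∈ Set.Icc (0 : ℝ) 1
  μ_mem : ∀ u v, μ u v ∈ Set.Icc (0 : ℝ) 1
  μ_symm : ∀ u v, μ u v = μ v u
  μ_self : ∀ v, μ v v = 0
  μ_le : ∀ u v, μ u v ≤ min (ν u) (ν v)

/-- The subgraph formed by some cycle of `G` has edge set `S`. Two cycles of `G` (as subgraphs)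
are equal iff they have the same edges, whatever the base point and orientation. -/
def SimpleGraph.IsCycleEdgeSet {V : Type*} (G : SimpleGraph V) (S : Set (Sym2 V)) : Prop :=
  ∃ (v : V) (p : G.Walk v v), p.IsCycle ∧ p.edgeSet = S

/-- A connected graph that contains exactly one cycle. -/
def SimpleGraph.IsConnectedUnicyclic {V : Type*} (G : SimpleGraph V) : Prop :=
  G.Connected ∧ ∃! S : Set (Sym2 V), G.IsCycleEdgeSet S

/-- `G` is a cycle of length `k` with a star attached: there is a cycle `p` of length `k` through
a vertex `c`, every vertex outside `p` is joined to `c`, and there are no other edges. So `G` is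
`C_k` with pendant vertices hanging from one vertex `c` of the cycle. -/
def SimpleGraph.IsCycleWithStar {V : Type*} (G : SimpleGraph V) (k : ℕ) : Prop :=
  ∃ (c : V) (p : G.Walk c c), p.IsCycle ∧ p.length = k ∧
    ∀ x y, G.Adj x y ↔
      s(x, y) ∈ p.edges ∨ (x = c ∧ y ∉ p.support) ∨ (y = c ∧ x ∉ p.support)

namespace FuzzyGraph

/-- The underlying crisp graph: `uv` is an edge iff `μ(uv) > 0`. -/
def graph {V : Type*} (Γ : FuzzyGraph V) : SimpleGraph V where
  Adj u v := 0 < Γ.μ u v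
  symm := ⟨fun u v h => by rw [Γ.μ_symm v u]; exact h⟩
  loopless := ⟨fun v h => by rw [Γ.μ_self v] at h; exact lt_irrefl _ h⟩

/-- The fuzzy degree `μ_u = ∑_v μ(uv)`. -/
noncomputable def degree {V : Type*} [Fintype V] (Γ : FuzzyGraph V) (u : V) : ℝ :=
  ∑ v, Γ.μ u v

/-- The contribution `μ(uv) * √(μ_u ^ 2 + μ_v ^ 2)` of an unordered pair `uv`. -/
noncomputable def somborTerm {V : Type*} [Fintype V] (Γ : FuzzyGraph V) : Sym2 V → ℝ :=
  Sym2.lift ⟨fun u v => Γ.μ u v * Real.sqrt (Γ.degree u ^ 2 + Γ.degree v ^ 2), fun u v => by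
    simp only [Γ.μ_symm u v, add_comm]⟩

/-- The membership `μ(uv)` of an unordered pair `uv`. -/
def edgeMembership {V : Type*} (Γ : FuzzyGraph V) : Sym2 V → ℝ :=
  Sym2.lift ⟨fun u v => Γ.μ u v, Γ.μ_symm⟩

open Classical in
/-- The fuzzy size `m_μ`: the sum of `μ(uv)` over the edges of the underlying graph. -/
noncomputable def size {V : Type*} [Fintype V] (Γ : FuzzyGraph V) : ℝ :=
  ∑ e ∈ Γ.graph.edgeFinset, Γ.edgeMembership e

open Classical in
/-- The fuzzy Sombor index: the sum of `μ(uv) * √(μ_u ^ 2 + μ_v ^ 2)` over the edges. -/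
noncomputable def sombor {V : Type*} [Fintype V] (Γ : FuzzyGraph V) : ℝ :=
  ∑ e ∈ Γ.graph.edgeFinset, Γ.somborTerm e

/-- A fuzzy unicyclic graph: the underlying crisp graph is connected with exactly one cycle. -/
def IsUnicyclic {V : Type*} (Γ : FuzzyGraph V) : Prop :=
  Γ.graph.IsConnectedUnicyclic

/-- The underlying crisp graph is the cycle through all `n = |V|` vertices. -/
def IsFuzzyCycle {V : Type*} [Fintype V] (Γ : FuzzyGraph V) : Prop :=
  Nonempty (Γ.graph ≃g SimpleGraph.cycleGraph (Fintype.card V))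

/-- A fuzzy cycle `C_n` all of whose edges have membership `p`. -/
def IsUniformFuzzyCycle {V : Type*} [Fintype V] (Γ : FuzzyGraph V) (p : ℝ) : Prop :=
  Γ.IsFuzzyCycle ∧ ∀ u v, Γ.graph.Adj u v → Γ.μ u v = p

end FuzzyGraph

/-! ### Crisp unicyclic graphs: the edge count. -/

namespace SimpleGraph

variable {V : Type*} {G : SimpleGraph V}

/-! Write `n` for the number of vertices; a connected graph is unicyclic exactly when it has `n`
edges.

Minimum: `√2 * √(a² + b²) ≥ a + b` gives `√2 * SO ≥ ∑ μ_u²`, and the variance identity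
`sum_sq_sub_mean` bounds this below by `(2m)² / n`. Equality makes all fuzzy degrees equal. Then
there is no leaf, so `n` edges on `n` vertices force a connected 2-regular graph, which is `C_n`.

Maximum, `m ≤ n - 1`: for an edge of weight `w`, the sum of the squared end degrees is at most `m² +
w²`. Spreading the lightest weight over the other `n - 1` edges strictly increases `∑ w √(m² + w²)`,
and the new value is that of a star with `n - 1` spokes. A star is not unicyclic, but giving a small
weight to one extra edge loses arbitrarily little. So every member is strictly beaten and no
maximiser exists.

Maximum, `m = n - 1 + ε` with `ε > 0`: compare with the triangle with a star whose spokes weigh 1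
and whose extra edge weighs `ε`. In any other shape every vertex misses two edges, so degrees are at
most `n - 2`, and at most one edge meets all others; this bounds `SO` strictly below
(`sombor_le_of_not_isCycleWithStar`, `somborBound_lt_of_three_le`). All edges weigh at least `ε`, so
the class is compact and a maximiser exists. -/

theorem ncard_edgeSet_deleteEdges_singleton [Finite V] {e : Sym2 V} (he : e ∈ G.edgeSet) :
    (G.deleteEdges {e}).edgeSet.ncard + 1 = G.edgeSet.ncard := by
  rw [edgeSet_deleteEdges]
  exact Set.ncard_sdiff_singleton_add_one he (Set.toFinite _)

theorem Connected.deleteEdges_of_mem_isCycle (hG : G.Connected) {v : V} {p : G.Walk v v}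
    (hp : p.IsCycle) {e : Sym2 V} (he : e ∈ p.edges) : (G.deleteEdges {e}).Connected := by
  induction e with
  | h x y =>
    exact hG.connected_delete_edge_of_not_isBridge fun hb => hb.notMem_edges_of_isCycle hp he

/-- Deleting an edge of the only cycle leaves a tree, which has one edge fewer than vertices. -/
theorem IsConnectedUnicyclic.ncard_edgeSet [Finite V] (hG : G.IsConnectedUnicyclic) :
    G.edgeSet.ncard = Nat.card V := by
  obtain ⟨hc, S, ⟨v, p, hp, rfl⟩, huniq⟩ := hG
  obtain ⟨e, he⟩ : ∃ e, e ∈ p.edges := by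
    obtain ⟨e, he⟩ := List.exists_mem_of_ne_nil _ (mt Walk.edges_eq_nil.mp
      (fun h => hp.not_nil h))
    exact ⟨e, he⟩
  have hacyc : (G.deleteEdges {e}).IsAcyclic := by
    intro w q hq
    have hq' : (q.mapLe (deleteEdges_le {e})).IsCycle := hq.mapLe _
    have h1 := huniq _ ⟨w, _, hq', rfl⟩
    have h2 : e ∈ (q.mapLe (deleteEdges_le {e})).edgeSet := by rw [h1]; exact he
    have h3 : e ∈ q.edges := by simpa [Walk.edgeSet] using h2
    have := q.edges_subset_edgeSet h3
    simp at this
  have ht : (G.deleteEdges {e}).IsTree := ⟨hc.deleteEdges_of_mem_isCycle hp he, hacyc⟩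
  have h1 := (isTree_iff_connected_and_card.mp ht).2
  rw [Nat.card_coe_set_eq, ncard_edgeSet_deleteEdges_singleton (p.edges_subset_edgeSet he)] at h1
  exact h1

/-- Deleting any edge of a cycle leaves a connected graph with the edge count of a tree. Hence every
other cycle uses that edge, and two cycles contain each other. -/
theorem Connected.isConnectedUnicyclic [Finite V] (hG : G.Connected)
    (hcard : G.edgeSet.ncard = Nat.card V) : G.IsConnectedUnicyclic := by
  have key : ∀ {v w : V} (p : G.Walk v v) (q : G.Walk w w), p.IsCycle → q.IsCycle →
      p.edgeSet ⊆ q.edgeSet := by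
    intro v w p q hp hq e he
    by_contra hne
    have he' : e ∈ p.edges := he
    have ht : (G.deleteEdges {e}).IsTree := by
      rw [isTree_iff_connected_and_card, Nat.card_coe_set_eq,
        ncard_edgeSet_deleteEdges_singleton (p.edges_subset_edgeSet he')]
      exact ⟨hG.deleteEdges_of_mem_isCycle hp he', hcard⟩
    have hq' : ∀ f ∈ q.edges, f ∉ ({e} : Set (Sym2 V)) := by
      rintro f hf rfl
      exact hne hf
    exact ht.isAcyclic _ (hq.toDeleteEdges G _ hq')
  have hex : ¬ G.IsAcyclic := by
    intro h
    have := (isTree_iff_connected_and_card.mp (⟨hG, h⟩ : G.IsTree)).2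
    rw [Nat.card_coe_set_eq] at this
    omega
  unfold IsAcyclic at hex
  push Not at hex
  obtain ⟨v, p, hp⟩ := hex
  refine ⟨hG, p.edgeSet, ⟨v, p, hp, rfl⟩, ?_⟩
  rintro S ⟨w, q, hq, rfl⟩
  exact (key q p hq hp).antisymm (key p q hp hq)

/-! ### Recognising a triangle with a star attached. -/

theorem isCycleWithStar_three_of_adj_iff {c a b : V} (ha : a ≠ c) (hb : b ≠ c) (hab : a ≠ b)
    (h : ∀ x y, G.Adj x y ↔ (x = c ∧ y ≠ c) ∨ (y = c ∧ x ≠ c) ∨ s(x, y) = s(a, b)) :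
    G.IsCycleWithStar 3 := by
  have h1 : G.Adj c a := (h _ _).2 (Or.inl ⟨rfl, ha⟩)
  have h2 : G.Adj a b := (h _ _).2 (Or.inr (Or.inr rfl))
  have h3 : G.Adj b c := (h _ _).2 (Or.inr (Or.inl ⟨rfl, hb⟩))
  refine ⟨c, .cons h1 (.cons h2 (.cons h3 .nil)), ?_, rfl, ?_⟩
  · simp [Walk.cons_isCycle_iff, ha, hb, hab, hb.symm, ha.symm]
  · intro x y
    rw [h]
    simp only [Walk.edges_cons, Walk.edges_nil, Walk.support_cons, Walk.support_nil,
      List.mem_cons, List.not_mem_nil, or_false, Sym2.eq_iff]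
    by_cases hxc : x = c <;> by_cases hyc : y = c <;> simp [hxc, hyc, ha.symm, hb.symm] <;> grind

theorem mk_mem_insert_image_mk_iff {a b c x y : V} :
    s(x, y) ∈ insert s(a, b) ((fun x => s(c, x)) '' {c}ᶜ) ↔
      (x = c ∧ y ≠ c) ∨ (y = c ∧ x ≠ c) ∨ s(x, y) = s(a, b) := by
  constructor
  · rintro (h | ⟨z, hz, h⟩)
    · exact Or.inr (Or.inr h)
    · have hz' : z ≠ c := hz
      rcases Sym2.eq_iff.1 h with ⟨rfl, rfl⟩ | ⟨rfl, rfl⟩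
      · exact Or.inl ⟨rfl, hz'⟩
      · exact Or.inr (Or.inl ⟨rfl, hz'⟩)
  · rintro (⟨rfl, h⟩ | ⟨rfl, h⟩ | h)
    · exact Or.inr ⟨y, h, rfl⟩
    · exact Or.inr ⟨x, h, Sym2.eq_swap⟩
    · exact Or.inl h

theorem isConnectedUnicyclic_of_adj_iff [Finite V] {c a b : V} (ha : a ≠ c) (hb : b ≠ c)
    (h : ∀ x y, G.Adj x y ↔ (x = c ∧ y ≠ c) ∨ (y = c ∧ x ≠ c) ∨ s(x, y) = s(a, b)) :
    G.IsConnectedUnicyclic := by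
  have hE : G.edgeSet = insert s(a, b) ((fun x => s(c, x)) '' {c}ᶜ) := by
    ext e
    induction e with
    | h x y =>
      rw [mem_edgeSet, h, mk_mem_insert_image_mk_iff]
  refine Connected.isConnectedUnicyclic ?_ ?_
  · refine (connected_iff_exists_forall_reachable _).2 ⟨c, fun w => ?_⟩
    by_cases hw : w = c
    · rw [hw]
    · exact Adj.reachable ((h _ _).2 (Or.inl ⟨rfl, hw⟩))
  · rw [hE, Set.ncard_insert_of_notMem _ (Set.toFinite _), Set.ncard_image_of_injective,
      ← Set.ncard_add_ncard_compl {c} (Set.toFinite _) (Set.toFinite _), Set.ncard_singleton,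
      add_comm]
    · intro x y hxy
      exact Sym2.congr_right.1 hxy
    · simp only [Set.mem_image, Sym2.eq_iff]
      grind

/-- The allowed pairs are the `n - 1` spokes at `c` and `ab`, at most `n` in all, so `n` edges must
use every one of them. -/
theorem isCycleWithStar_three_of_forall_edge [Finite V] (hcard : G.edgeSet.ncard = Nat.card V)
    {c a b : V} (ha : a ≠ c) (hb : b ≠ c)
    (h : ∀ e ∈ G.edgeSet, c ∈ e ∨ e = s(a, b)) : G.IsCycleWithStar 3 := by
  have hsub : G.edgeSet ⊆ insert s(a, b) ((fun x => s(c, x)) '' {c}ᶜ) := by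
    intro e he
    rcases h e he with hc | rfl
    · obtain ⟨x, rfl⟩ := hc
      exact Set.mem_insert_of_mem _ ⟨x, fun hx => (G.ne_of_adj he) hx.symm, rfl⟩
    · exact Set.mem_insert _ _
  have hE := Set.eq_of_subset_of_ncard_le hsub (by
    refine (Set.ncard_insert_le _ _).trans ?_
    rw [hcard, ← Set.ncard_add_ncard_compl {c} (Set.toFinite _) (Set.toFinite _),
      Set.ncard_singleton, add_comm]
    exact Nat.add_le_add_left (Set.ncard_image_le (Set.toFinite _)) _) (Set.toFinite _)
  have hadj : G.Adj a b := by
    rw [← mem_edgeSet, hE]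
    exact Set.mem_insert _ _
  refine isCycleWithStar_three_of_adj_iff ha hb hadj.ne fun x y => ?_
  rw [← mem_edgeSet, hE, mk_mem_insert_image_mk_iff]

/-- If all edges but at most one contain `c`, a unicyclic graph is a triangle with a star. -/
theorem isCycleWithStar_three_of_pairwise [Finite V] (hcard : G.edgeSet.ncard = Nat.card V)
    {c : V} (h : ∀ e ∈ G.edgeSet, ∀ f ∈ G.edgeSet, c ∉ e → c ∉ f → e = f) :
    G.IsCycleWithStar 3 := by
  obtain ⟨e, he, hce⟩ : ∃ e ∈ G.edgeSet, c ∉ e := by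
    by_contra! hne
    have hsub : G.edgeSet ⊆ (fun x => s(c, x)) '' {c}ᶜ := by
      intro e he
      obtain ⟨x, rfl⟩ := hne e he
      exact ⟨x, fun hx => (G.ne_of_adj he) hx.symm, rfl⟩
    have h1 := (Set.ncard_le_ncard hsub (Set.toFinite _)).trans
      (Set.ncard_image_le (Set.toFinite _))
    have h2 := Set.ncard_add_ncard_compl {c} (Set.toFinite _) (Set.toFinite _)
    rw [Set.ncard_singleton] at h2
    omega
  induction e with
  | h a b =>
    rw [Sym2.mem_iff, not_or] at hce
    refine isCycleWithStar_three_of_forall_edge hcard (Ne.symm hce.1) (Ne.symm hce.2)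
      fun f hf => or_iff_not_imp_left.2 fun hcf => h f hf _ he hcf ?_
    rw [Sym2.mem_iff, not_or]
    exact hce

/-- If two different edges both meet all edges, a unicyclic graph is a triangle with a star. -/
theorem isCycleWithStar_three_of_two_dominating [Finite V]
    (hcard : G.edgeSet.ncard = Nat.card V) {e f : Sym2 V} (he : e ∈ G.edgeSet)
    (hf : f ∈ G.edgeSet) (hef : e ≠ f) (hde : ∀ g ∈ G.edgeSet, ∃ x ∈ e, x ∈ g)
    (hdf : ∀ g ∈ G.edgeSet, ∃ x ∈ f, x ∈ g) : G.IsCycleWithStar 3 := by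
  obtain ⟨v, hve, hvf⟩ := hde f hf
  -- The two edges are `va` and `vb`; an edge avoiding `v` must meet them in `a` and in `b`, so it
  -- is `ab`.
  obtain ⟨a, rfl⟩ := hve
  obtain ⟨b, rfl⟩ := hvf
  refine isCycleWithStar_three_of_forall_edge hcard (c := v) (a := a) (b := b)
    (G.ne_of_adj he).symm (G.ne_of_adj hf).symm fun g hg => ?_
  have h1 := hde g hg
  have h2 := hdf g hg
  have hab : a ≠ b := fun h => hef (by rw [h])
  by_cases hv : v ∈ g
  · exact Or.inl hv
  · refine Or.inr ((Sym2.mem_and_mem_iff hab).1 ⟨?_, ?_⟩)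
    · obtain ⟨x, hx, hxg⟩ := h1
      rcases Sym2.mem_iff.1 hx with rfl | rfl
      · exact absurd hxg hv
      · exact hxg
    · obtain ⟨x, hx, hxg⟩ := h2
      rcases Sym2.mem_iff.1 hx with rfl | rfl
      · exact absurd hxg hv
      · exact hxg

/-! ### Recognising the cycle on all vertices. -/

/-- A cycle fills the whole component, so it is Hamiltonian and gives a bijective copy of the cycle
graph inside `G`. Since both graphs are 2-regular, the copy has no missing edges. -/
theorem Connected.nonempty_iso_cycleGraph [Fintype V] (hG : G.Connected)
    (hn : 3 ≤ Fintype.card V) (h2 : ∀ v, (G.neighborSet v).ncard = 2) :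
    Nonempty (G ≃g cycleGraph (Fintype.card V)) := by
  classical
  have hcyc : G.IsCycles := fun v _ => h2 v
  obtain ⟨v⟩ := hG.nonempty
  obtain ⟨p, hp, hpv⟩ := hcyc.exists_cycle_toSubgraph_verts_eq_connectedComponentSupp
    (c := G.connectedComponentMk v) (v := v) rfl
    (Set.nonempty_of_ncard_ne_zero (by rw [h2]; decide))
  have hsupp : ∀ w, w ∈ p.support := by
    intro w
    rw [← Walk.mem_verts_toSubgraph, hpv]
    exact ConnectedComponent.sound (hG.preconnected w v)
  have hlen : p.length = Fintype.card V := by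
    refine Walk.IsHamiltonianCycle.length_eq
      (Walk.isHamiltonianCycle_isCycle_and_isHamiltonian_tail.2 ⟨hp,
        hp.isPath_tail.isHamiltonian_of_mem fun w => ?_⟩)
    rw [Walk.support_tail_of_not_nil _ hp.not_nil]
    by_cases hw : w = v
    · rw [hw]
      exact Walk.end_mem_tail_support hp.not_nil
    · have := hsupp w
      rw [Walk.mem_support_iff] at this
      exact this.resolve_left hw
  obtain ⟨f⟩ := (cycleGraph_isContained_iff hn).2 ⟨v, p, hp, hlen⟩
  have hbij : Function.Bijective f := by
    rw [Fintype.bijective_iff_injective_and_card]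
    exact ⟨f.injective, by simp⟩
  refine ⟨(RelIso.symm ⟨Equiv.ofBijective f hbij, ?_⟩)⟩
  intro x y
  refine ⟨fun hxy => ?_, fun hxy => f.toHom.map_adj hxy⟩
  have himg : f '' (cycleGraph (Fintype.card V)).neighborSet x = G.neighborSet (f x) := by
    refine Set.eq_of_subset_of_ncard_le ?_ ?_ (Set.toFinite _)
    · rintro _ ⟨z, hz, rfl⟩
      exact f.toHom.map_adj hz
    · rw [h2, Set.ncard_image_of_injective (f := f) _ f.injective]
      obtain ⟨k, hk⟩ : ∃ k, Fintype.card V = k + 3 := ⟨_, (Nat.sub_add_cancel hn).symm⟩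
      generalize Fintype.card V = n at *
      subst hk
      rw [← cycleGraph_degree_three_le (v := x), ← card_neighborSet_eq_degree,
        ← Nat.card_eq_fintype_card, Nat.card_coe_set_eq]
  have : f y ∈ G.neighborSet (f x) := hxy
  rw [← himg] at this
  obtain ⟨z, hz, hzy⟩ := this
  rwa [← f.injective hzy]

theorem sum_ncard_neighborSet [Fintype V] :
    ∑ v, (G.neighborSet v).ncard = 2 * G.edgeSet.ncard := by
  classical
  have := G.sum_degrees_eq_twice_card_edges
  simp only [Set.ncard_eq_toFinset_card', Set.toFinset_card, card_neighborSet_eq_degree]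
  rw [this, edgeFinset_card]

theorem IsConnectedUnicyclic.nonempty_iso_cycleGraph [Fintype V] (hG : G.IsConnectedUnicyclic)
    (hn : 3 ≤ Fintype.card V) (h2 : ∀ v, 2 ≤ (G.neighborSet v).ncard) :
    Nonempty (G ≃g cycleGraph (Fintype.card V)) := by
  refine hG.1.nonempty_iso_cycleGraph hn ?_
  have hs : ∑ v : V, 2 = ∑ v, (G.neighborSet v).ncard := by
    rw [sum_ncard_neighborSet, hG.ncard_edgeSet]
    simp [mul_comm]
  intro v
  exact ((Finset.sum_eq_sum_iff_of_le fun v _ => h2 v).1 hs v (Finset.mem_univ v)).symm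

theorem ncard_neighborSet_of_iso_cycleGraph [Fintype V] (hn : 3 ≤ Fintype.card V)
    (e : G ≃g cycleGraph (Fintype.card V)) (v : V) : (G.neighborSet v).ncard = 2 := by
  rw [← Nat.card_coe_set_eq, Nat.card_congr (e.mapNeighborSet v)]
  obtain ⟨k, hk⟩ : ∃ k, Fintype.card V = k + 3 := ⟨_, (Nat.sub_add_cancel hn).symm⟩
  generalize Fintype.card V = n at *
  subst hk
  rw [← cycleGraph_degree_three_le (v := e v), ← card_neighborSet_eq_degree,
    ← Nat.card_eq_fintype_card]

theorem isConnectedUnicyclic_of_iso_cycleGraph [Fintype V] (hn : 3 ≤ Fintype.card V)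
    (e : G ≃g cycleGraph (Fintype.card V)) : G.IsConnectedUnicyclic := by
  have hdeg := ncard_neighborSet_of_iso_cycleGraph hn e
  have hc : G.Connected := by
    rw [e.connected_iff]
    obtain ⟨k, hk⟩ : ∃ k, Fintype.card V = k + 1 := ⟨_, (Nat.sub_add_cancel (by omega)).symm⟩
    rw [hk]
    exact cycleGraph_connected
  refine hc.isConnectedUnicyclic ?_
  have h := G.sum_ncard_neighborSet
  simp only [hdeg, Finset.sum_const, Finset.card_univ, smul_eq_mul] at h
  rw [Nat.card_eq_fintype_card]
  omega

end SimpleGraph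

/-! ### Double counting for fuzzy degree, size and Sombor index. -/

namespace FuzzyGraph

variable {V : Type*}

theorem μ_nonneg (Γ : FuzzyGraph V) (u v : V) : 0 ≤ Γ.μ u v := (Γ.μ_mem u v).1

theorem μ_le_one (Γ : FuzzyGraph V) (u v : V) : Γ.μ u v ≤ 1 := (Γ.μ_mem u v).2

theorem μ_eq_zero (Γ : FuzzyGraph V) {u v : V} (h : ¬ Γ.graph.Adj u v) : Γ.μ u v = 0 :=
  le_antisymm (not_lt.1 h) (Γ.μ_nonneg u v)

theorem edgeMembership_pos (Γ : FuzzyGraph V) {e : Sym2 V} (he : e ∈ Γ.graph.edgeSet) :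
    0 < Γ.edgeMembership e := by
  induction e with
  | h u v => exact he

theorem edgeMembership_le_one (Γ : FuzzyGraph V) (e : Sym2 V) : Γ.edgeMembership e ≤ 1 := by
  induction e with
  | h u v => exact Γ.μ_le_one u v

variable [Fintype V]

theorem degree_nonneg (Γ : FuzzyGraph V) (u : V) : 0 ≤ Γ.degree u :=
  Finset.sum_nonneg fun v _ => Γ.μ_nonneg u v

theorem μ_le_degree (Γ : FuzzyGraph V) (u v : V) : Γ.μ u v ≤ Γ.degree u :=
  Finset.single_le_sum (f := fun v => Γ.μ u v) (fun v _ => Γ.μ_nonneg u v) (Finset.mem_univ v)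

-- Each edge carries exactly two darts. This turns sums over edges into double sums over vertices.
open Classical in
theorem two_mul_sum_edgeFinset_lift (G : SimpleGraph V) (F : V → V → ℝ)
    (hF : ∀ u v, F u v = F v u) (h0 : ∀ u v, ¬ G.Adj u v → F u v = 0) :
    2 * ∑ e ∈ G.edgeFinset, Sym2.lift ⟨F, hF⟩ e = ∑ u, ∑ v, F u v := by
  have h1 : ∑ d : G.Dart, F d.fst d.snd = ∑ u, ∑ v, F u v := by
    rw [← Fintype.sum_prod_type' (fun u v => F u v)]
    have hinj : Function.Injective fun d : G.Dart => d.toProd := fun _ _ h =>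
      SimpleGraph.Dart.ext _ _ h
    refine Finset.sum_of_injOn (fun d : G.Dart => d.toProd) hinj.injOn
      (fun _ _ => Finset.mem_univ _) ?_ (fun _ _ => rfl)
    rintro ⟨u, v⟩ _ hne
    refine h0 u v fun hadj => hne ⟨⟨(u, v), hadj⟩, ?_, rfl⟩
    simp
  rw [← h1, ← Finset.sum_fiberwise_of_maps_to (s := Finset.univ) (t := G.edgeFinset)
    (g := fun d : G.Dart => d.edge)
    (fun d _ => SimpleGraph.mem_edgeFinset.2 d.edge_mem), Finset.mul_sum]
  refine Finset.sum_congr rfl fun e he => ?_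
  rw [Finset.sum_congr rfl (g := fun _ => Sym2.lift ⟨F, hF⟩ e), Finset.sum_const,
    G.dart_edge_fiber_card e (SimpleGraph.mem_edgeFinset.1 he), nsmul_eq_mul, Nat.cast_ofNat]
  intro d hd
  rw [← (Finset.mem_filter.1 hd).2]
  rfl

theorem two_mul_size (Γ : FuzzyGraph V) : 2 * Γ.size = ∑ u, Γ.degree u :=
  two_mul_sum_edgeFinset_lift Γ.graph _ Γ.μ_symm fun _ _ => Γ.μ_eq_zero

theorem two_mul_sombor (Γ : FuzzyGraph V) :
    2 * Γ.sombor = ∑ u, ∑ v, Γ.μ u v * √(Γ.degree u ^ 2 + Γ.degree v ^ 2) :=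
  two_mul_sum_edgeFinset_lift Γ.graph _ _ fun u v h => by rw [Γ.μ_eq_zero h, zero_mul]

open Classical in
theorem degree_eq_sum_edgeFinset (Γ : FuzzyGraph V) (u : V) :
    Γ.degree u = ∑ e ∈ Γ.graph.edgeFinset with u ∈ e, Γ.edgeMembership e := by
  have h : Γ.degree u = ∑ v with Γ.graph.Adj u v, Γ.μ u v :=
    (Finset.sum_filter_of_ne fun v _ hv => by_contra fun hn => hv (Γ.μ_eq_zero hn)).symm
  rw [h]
  refine Finset.sum_of_injOn (fun v => s(u, v)) (fun v _ w _ hvw => Sym2.congr_right.1 hvw) ?_ ?_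
    (fun _ _ => rfl)
  · intro v hv
    simpa using hv
  · rintro e he hne
    obtain ⟨he, v, rfl⟩ := Finset.mem_filter.1 he
    exact absurd ⟨v, by simpa using he, rfl⟩ hne

open Classical in
theorem degree_add_sum_le_size (Γ : FuzzyGraph V) {u : V} {F : Finset (Sym2 V)}
    (hF : F ⊆ Γ.graph.edgeFinset) (hu : ∀ e ∈ F, u ∉ e) :
    Γ.degree u + ∑ e ∈ F, Γ.edgeMembership e ≤ Γ.size := by
  rw [degree_eq_sum_edgeFinset, ← Finset.sum_union]
  · exact Finset.sum_le_sum_of_subset_of_nonneg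
      (Finset.union_subset (Finset.filter_subset _ _) hF) fun e he _ =>
        (Γ.edgeMembership_pos (SimpleGraph.mem_edgeFinset.1 he)).le
  · rw [Finset.disjoint_left]
    intro e he heF
    exact hu e heF (Finset.mem_filter.1 he).2

-- Inclusion–exclusion: the only edge counted at both `u` and `v` is `uv`, and the edges of `F` are
-- disjoint from both stars.
open Classical in
theorem degree_add_degree_add_sum_le (Γ : FuzzyGraph V) {u v : V} (huv : u ≠ v)
    {F : Finset (Sym2 V)} (hF : F ⊆ Γ.graph.edgeFinset) (hu : ∀ e ∈ F, u ∉ e)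
    (hv : ∀ e ∈ F, v ∉ e) :
    Γ.degree u + Γ.degree v + ∑ e ∈ F, Γ.edgeMembership e ≤ Γ.size + Γ.μ u v := by
  have h1 := Finset.sum_union_inter (s₁ := {e ∈ Γ.graph.edgeFinset | u ∈ e})
    (s₂ := {e ∈ Γ.graph.edgeFinset | v ∈ e}) (f := Γ.edgeMembership)
  rw [← degree_eq_sum_edgeFinset, ← degree_eq_sum_edgeFinset] at h1
  have h2 : ∑ e ∈ {e ∈ Γ.graph.edgeFinset | u ∈ e} ∩ {e ∈ Γ.graph.edgeFinset | v ∈ e},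
      Γ.edgeMembership e ≤ Γ.μ u v := by
    refine (Finset.sum_le_sum_of_subset_of_nonneg (t := {s(u, v)}) ?_ ?_).trans_eq
      (Finset.sum_singleton _ _)
    · intro e he
      simp only [Finset.mem_inter, Finset.mem_filter] at he
      exact Finset.mem_singleton.2 ((Sym2.mem_and_mem_iff huv).1 ⟨he.1.2, he.2.2⟩)
    · intro e he _
      rw [Finset.mem_singleton.1 he]
      exact Γ.μ_nonneg u v
  have h3 : ∑ e ∈ {e ∈ Γ.graph.edgeFinset | u ∈ e} ∪ {e ∈ Γ.graph.edgeFinset | v ∈ e},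
      Γ.edgeMembership e + ∑ e ∈ F, Γ.edgeMembership e ≤ Γ.size := by
    rw [← Finset.sum_union]
    · exact Finset.sum_le_sum_of_subset_of_nonneg
        (Finset.union_subset (Finset.union_subset (Finset.filter_subset _ _)
          (Finset.filter_subset _ _)) hF) fun e he _ =>
          (Γ.edgeMembership_pos (SimpleGraph.mem_edgeFinset.1 he)).le
    · rw [Finset.disjoint_left]
      intro e he heF
      rcases Finset.mem_union.1 he with h | h
      · exact hu e heF (Finset.mem_filter.1 h).2
      · exact hv e heF (Finset.mem_filter.1 h).2
  linarith

theorem degree_le_size (Γ : FuzzyGraph V) (u : V) : Γ.degree u ≤ Γ.size := by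
  simpa using Γ.degree_add_sum_le_size (u := u) (Finset.empty_subset _) (by simp)

theorem degree_add_degree_le (Γ : FuzzyGraph V) {u v : V} (huv : u ≠ v) :
    Γ.degree u + Γ.degree v ≤ Γ.size + Γ.μ u v := by
  simpa using Γ.degree_add_degree_add_sum_le huv (Finset.empty_subset _) (by simp) (by simp)

open Classical in
theorem card_edgeFinset (Γ : FuzzyGraph V) (hΓ : Γ.IsUnicyclic) :
    Γ.graph.edgeFinset.card = Fintype.card V := by
  have h := SimpleGraph.IsConnectedUnicyclic.ncard_edgeSet hΓ
  rw [Nat.card_eq_fintype_card, Set.ncard_eq_toFinset_card'] at h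
  exact h

/-! ### The lower bound -/

theorem sum_degree_sq_eq (Γ : FuzzyGraph V) :
    ∑ u, ∑ v, Γ.μ u v * (Γ.degree u + Γ.degree v) = 2 * ∑ u, Γ.degree u ^ 2 := by
  have h1 : ∑ u, ∑ v, Γ.μ u v * Γ.degree u = ∑ u, Γ.degree u ^ 2 := by
    refine Finset.sum_congr rfl fun u _ => ?_
    rw [← Finset.sum_mul, sq]
    rfl
  have h2 : ∑ u, ∑ v, Γ.μ u v * Γ.degree v = ∑ u, Γ.degree u ^ 2 := by
    rw [Finset.sum_comm, ← h1]
    simp only [Γ.μ_symm]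
  simp only [mul_add, Finset.sum_add_distrib, h1, h2]
  ring

theorem sum_degree_sq_le_sqrt_two_mul_sombor (Γ : FuzzyGraph V) :
    ∑ u, Γ.degree u ^ 2 ≤ √2 * Γ.sombor := by
  have h : ∑ u, ∑ v, Γ.μ u v * (Γ.degree u + Γ.degree v) ≤ √2 * (2 * Γ.sombor) := by
    rw [two_mul_sombor, Finset.mul_sum]
    refine Finset.sum_le_sum fun u _ => ?_
    rw [Finset.mul_sum]
    refine Finset.sum_le_sum fun v _ => ?_
    rw [mul_left_comm, ← Real.sqrt_mul zero_le_two]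
    refine mul_le_mul_of_nonneg_left (Real.le_sqrt_of_sq_le ?_) (Γ.μ_nonneg u v)
    nlinarith [sq_nonneg (Γ.degree u - Γ.degree v)]
  rw [sum_degree_sq_eq] at h
  linarith

theorem sombor_of_degree_eq (Γ : FuzzyGraph V) {d : ℝ} (h : ∀ u, Γ.degree u = d) :
    Γ.sombor = √2 * d * Γ.size := by
  -- On an empty vertex set `d` is arbitrary and may be negative.
  have hd : 0 ≤ d ∨ IsEmpty V := by
    by_cases hV : IsEmpty V
    · exact Or.inr hV
    · obtain ⟨u⟩ := not_isEmpty_iff.1 hV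
      exact Or.inl (h u ▸ Γ.degree_nonneg u)
  rcases hd with hd | hV
  · have h1 := Γ.two_mul_sombor
    have h2 := Γ.two_mul_size
    have h3 : √(d ^ 2 + d ^ 2) = √2 * d := by
      rw [← two_mul, Real.sqrt_mul zero_le_two, Real.sqrt_sq hd]
    simp only [h, h3, ← Finset.sum_mul] at h1
    have h4 : ∑ u, ∑ v, Γ.μ u v = 2 * Γ.size := h2.symm
    rw [h4] at h1
    linarith
  · have h1 := Γ.two_mul_sombor
    have h2 := Γ.two_mul_size
    simp only [Finset.univ_eq_empty, Finset.sum_empty] at h1 h2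
    rw [show Γ.sombor = 0 by linarith, show Γ.size = 0 by linarith, mul_zero]

/-- The mean degree is `2m / n`. Keeping the variance exact, instead of using Cauchy–Schwarz,
retains the equality case. -/
theorem sum_sq_sub_mean (Γ : FuzzyGraph V) [Nonempty V] :
    ∑ u, (Γ.degree u - 2 * Γ.size / Fintype.card V) ^ 2 =
      ∑ u, Γ.degree u ^ 2 - (2 * Γ.size) ^ 2 / Fintype.card V := by
  have hn : (Fintype.card V : ℝ) ≠ 0 := by positivity
  simp only [sub_sq, Finset.sum_add_distrib, Finset.sum_sub_distrib, ← Finset.sum_mul,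
    ← Finset.mul_sum, ← two_mul_size, Finset.sum_const, Finset.card_univ, nsmul_eq_mul]
  field_simp
  ring

/-- If `v` had a single neighbour `w`, the edge `vw` would carry the full degree `d`, leaving no
weight for other edges at `w`. Then `{v, w}` would be a whole component, against `n ≥ 3`. -/
theorem two_le_ncard_neighborSet (Γ : FuzzyGraph V) (hΓ : Γ.graph.Connected)
    (hn : 3 ≤ Fintype.card V) {d : ℝ} (h : ∀ u, Γ.degree u = d) (v : V) :
    2 ≤ (Γ.graph.neighborSet v).ncard := by
  classical
  have : Nontrivial V := Fintype.one_lt_card_iff_nontrivial.1 (by omega)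
  obtain ⟨w, hw⟩ := hΓ.preconnected.exists_adj_of_nontrivial v
  by_contra hlt
  have h1 : ∀ x, Γ.graph.Adj v x → x = w := by
    intro x hx
    exact (Set.ncard_le_one_iff (s := Γ.graph.neighborSet v) (Set.toFinite _)).1 (by omega) hx hw
  have h2 : Γ.degree v = Γ.μ v w :=
    Finset.sum_eq_single w (fun x _ hx => Γ.μ_eq_zero fun hadj => hx (h1 x hadj)) (by simp)
  have h3 : ∀ x, Γ.graph.Adj w x → x = v := by
    intro x hx
    by_contra hxv
    have h4 : Γ.μ w v + Γ.μ w x ≤ Γ.degree w := by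
      rw [← Finset.sum_pair (f := fun y => Γ.μ w y) (Ne.symm hxv)]
      exact Finset.sum_le_sum_of_subset_of_nonneg (Finset.subset_univ _)
        fun y _ _ => Γ.μ_nonneg w y
    have h5 : 0 < Γ.μ w x := hx
    rw [h w, ← h v, h2, Γ.μ_symm v w] at h4
    linarith
  have h6 : ∀ x, Γ.graph.Reachable v x → x = v ∨ x = w := by
    intro x hx
    rw [SimpleGraph.reachable_iff_reflTransGen] at hx
    induction hx with
    | refl => exact Or.inl rfl
    | tail _ hadj ih =>
      rcases ih with rfl | rfl
      · exact Or.inr (h1 _ hadj)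
      · exact Or.inl (h3 _ hadj)
  obtain ⟨x, hx⟩ : ∃ x, x ∉ ({v, w} : Finset V) := by
    by_contra! hall
    have := Finset.card_le_card (fun x _ => hall x : Finset.univ ⊆ ({v, w} : Finset V))
    have h7 := Finset.card_le_two (a := v) (b := w)
    rw [Finset.card_univ] at this
    omega
  simp only [Finset.mem_insert, Finset.mem_singleton] at hx
  exact hx (h6 x (hΓ.preconnected v x))

theorem IsUniformFuzzyCycle.degree_eq {Γ : FuzzyGraph V} {p : ℝ} (h : Γ.IsUniformFuzzyCycle p)
    (hn : 3 ≤ Fintype.card V) (u : V) : Γ.degree u = 2 * p := by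
  classical
  obtain ⟨⟨e⟩, hp⟩ := h
  have h1 : Γ.degree u = ∑ v with Γ.graph.Adj u v, p := by
    rw [Finset.sum_congr rfl (g := fun v => Γ.μ u v)
      fun v hv => (hp u v (Finset.mem_filter.1 hv).2).symm]
    exact (Finset.sum_filter_of_ne fun v _ hv => by_contra fun hn => hv (Γ.μ_eq_zero hn)).symm
  have h2 : (Γ.graph.neighborSet u).ncard = 2 :=
    SimpleGraph.ncard_neighborSet_of_iso_cycleGraph hn e u
  rw [h1, Finset.sum_const, nsmul_eq_mul]
  rw [Set.ncard_eq_toFinset_card'] at h2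
  rw [show ({v | Γ.graph.Adj u v} : Finset V) = (Γ.graph.neighborSet u).toFinset by ext; simp, h2]
  norm_num

theorem IsUniformFuzzyCycle.size_eq {Γ : FuzzyGraph V} {p : ℝ} (h : Γ.IsUniformFuzzyCycle p)
    (hn : 3 ≤ Fintype.card V) : Γ.size = Fintype.card V * p := by
  have h1 := Γ.two_mul_size
  simp only [h.degree_eq hn, Finset.sum_const, Finset.card_univ, nsmul_eq_mul] at h1
  linarith

theorem IsFuzzyCycle.isUnicyclic {Γ : FuzzyGraph V} (h : Γ.IsFuzzyCycle)
    (hn : 3 ≤ Fintype.card V) : Γ.IsUnicyclic := by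
  obtain ⟨e⟩ := h
  exact SimpleGraph.isConnectedUnicyclic_of_iso_cycleGraph hn e

theorem exists_isUniformFuzzyCycle {p : ℝ} (hp : 0 < p) (hp1 : p ≤ 1) :
    ∃ Γ : FuzzyGraph V, Γ.IsUniformFuzzyCycle p := by
  classical
  let e : V ≃ Fin (Fintype.card V) := Fintype.equivFin V
  let G := (SimpleGraph.cycleGraph (Fintype.card V)).comap e
  refine ⟨{ ν := fun _ => 1
            μ := fun u v => if G.Adj u v then p else 0
            ν_mem := fun _ => by simp
            μ_mem := fun u v => by
              split_ifs
              · exact ⟨hp.le, hp1⟩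
              · simp
            μ_symm := fun u v => by simp only [G.adj_comm]
            μ_self := fun v => by simp
            μ_le := fun u v => by
              simp only [min_self]
              split_ifs
              · exact hp1
              · exact zero_le_one }, ⟨⟨e, ?_⟩⟩, ?_⟩
  · intro u v
    change _ ↔ 0 < (if G.Adj u v then p else 0)
    split_ifs with h
    · exact ⟨fun _ => hp, fun _ => h⟩
    · exact ⟨fun h' => absurd h' h, fun h' => absurd h' (lt_irrefl _)⟩
  · intro u v h
    change 0 < (if G.Adj u v then p else 0) at h
    change (if G.Adj u v then p else 0) = p
    split_ifs at h ⊢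
    · rfl
    · exact absurd h (lt_irrefl _)

theorem IsUniformFuzzyCycle.isMinimal {Γ₀ : FuzzyGraph V} (hn : 3 ≤ Fintype.card V) {m : ℝ}
    (h : Γ₀.IsUniformFuzzyCycle (m / Fintype.card V)) {Γ : FuzzyGraph V} (hΓ : Γ.IsUnicyclic)
    (hm : Γ.size = m) :
    Γ₀.sombor ≤ Γ.sombor ∧ (Γ.sombor = Γ₀.sombor → Γ.IsFuzzyCycle) := by
  have : Nonempty V := Fintype.card_pos_iff.1 (by omega)
  have hn0 : (Fintype.card V : ℝ) ≠ 0 := by positivity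
  have hm0 : Γ₀.size = m := by rw [h.size_eq hn, mul_div_cancel₀ _ hn0]
  have h0 : √2 * Γ₀.sombor = (2 * m) ^ 2 / Fintype.card V := by
    rw [Γ₀.sombor_of_degree_eq (h.degree_eq hn), hm0]
    have := Real.mul_self_sqrt (zero_le_two : (0 : ℝ) ≤ 2)
    field_simp
    rw [Real.sq_sqrt zero_le_two]
  have h1 := Γ.sum_degree_sq_le_sqrt_two_mul_sombor
  have h2 := Γ.sum_sq_sub_mean
  rw [hm] at h2
  have h3 : 0 ≤ ∑ u, (Γ.degree u - 2 * m / Fintype.card V) ^ 2 :=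
    Finset.sum_nonneg fun _ _ => sq_nonneg _
  have hs : 0 < √2 := by positivity
  refine ⟨le_of_mul_le_mul_left (by linarith) hs, fun heq => ?_⟩
  rw [heq] at h1
  have h4 : ∑ u, (Γ.degree u - 2 * m / Fintype.card V) ^ 2 = 0 := by linarith
  rw [Finset.sum_eq_zero_iff_of_nonneg fun _ _ => sq_nonneg _] at h4
  exact SimpleGraph.IsConnectedUnicyclic.nonempty_iso_cycleGraph hΓ hn
    (Γ.two_le_ncard_neighborSet hΓ.1 hn (d := 2 * m / Fintype.card V) fun u => by
      have := h4 u (Finset.mem_univ u)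
      rw [sq_eq_zero_iff] at this
      linarith)

end FuzzyGraph

namespace FuzzyGraph

variable {V : Type*}

/-! ### Triangles with a star attached -/

open Classical in
/-- The fuzzy graph with spokes `cv` of membership `x v` and one further edge `ab` of
membership `q`. -/
noncomputable def triangleStar (c a b : V) (x : V → ℝ) (q : ℝ) (hx : ∀ v, x v ∈ Set.Ioc (0 : ℝ) 1)
    (hq : q ∈ Set.Ioc (0 : ℝ) 1) : FuzzyGraph V where
  ν _ := 1
  μ u v := if u = v then 0 else if u = c then x v else if v = c then x u else
    if s(u, v) = s(a, b) then q else 0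
  ν_mem _ := ⟨zero_le_one, le_rfl⟩
  μ_mem u v := by
    split_ifs
    exacts [⟨le_rfl, zero_le_one⟩, ⟨(hx _).1.le, (hx _).2⟩, ⟨(hx _).1.le, (hx _).2⟩,
      ⟨hq.1.le, hq.2⟩, ⟨le_rfl, zero_le_one⟩]
  μ_symm u v := by
    rw [Sym2.eq_swap (a := u)]
    split_ifs <;> simp_all
  μ_self v := if_pos rfl
  μ_le u v := by
    rw [min_self]
    split_ifs
    exacts [zero_le_one, (hx _).2, (hx _).2, hq.2, zero_le_one]

section

variable {c a b : V} {x : V → ℝ} {q : ℝ} {hx : ∀ v, x v ∈ Set.Ioc (0 : ℝ) 1}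
  {hq : q ∈ Set.Ioc (0 : ℝ) 1}

theorem triangleStar_μ_center {v : V} (hv : v ≠ c) :
    (triangleStar c a b x q hx hq).μ c v = x v := by
  simp [triangleStar, hv.symm]

theorem triangleStar_μ_base (ha : a ≠ c) (hb : b ≠ c) (hab : a ≠ b) :
    (triangleStar c a b x q hx hq).μ a b = q := by
  simp [triangleStar, ha, hb, hab]

theorem triangleStar_graph_adj (hab : a ≠ b) (u v : V) :
    (triangleStar c a b x q hx hq).graph.Adj u v ↔
      (u = c ∧ v ≠ c) ∨ (v = c ∧ u ≠ c) ∨ s(u, v) = s(a, b) := by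
  classical
  change 0 < ite _ _ _ ↔ _
  have h1 := hq.1
  have h2 := fun v => (hx v).1
  simp only [Sym2.eq_iff]
  split_ifs <;> simp_all <;> grind

theorem triangleStar_isCycleWithStar (ha : a ≠ c) (hb : b ≠ c) (hab : a ≠ b) :
    (triangleStar c a b x q hx hq).graph.IsCycleWithStar 3 :=
  SimpleGraph.isCycleWithStar_three_of_adj_iff ha hb hab (triangleStar_graph_adj hab)

theorem triangleStar_isUnicyclic [Finite V] (ha : a ≠ c) (hb : b ≠ c) (hab : a ≠ b) :
    (triangleStar c a b x q hx hq).IsUnicyclic :=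
  SimpleGraph.isConnectedUnicyclic_of_adj_iff ha hb (triangleStar_graph_adj hab)

variable [Fintype V]

open Classical in
theorem triangleStar_sum_μ_mul (ha : a ≠ c) (hb : b ≠ c) (hab : a ≠ b) (F : V → V → ℝ)
    (hF : ∀ u v, F u v = F v u) :
    ∑ u, ∑ v, (triangleStar c a b x q hx hq).μ u v * F u v =
      2 * (∑ v ∈ Finset.univ.erase c, x v * F c v + q * F a b) := by
  -- The nonzero entries split into the ordered pairs `(c, v)`, `(v, c)`, `(a, b)` and `(b, a)`.
  have h : ∀ u v, (triangleStar c a b x q hx hq).μ u v * F u v =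
      (if u = c then (if v ≠ c then x v * F c v else 0) else 0) +
      (if v = c then (if u ≠ c then x u * F c u else 0) else 0) +
      (if u = a then (if v = b then q * F a b else 0) else 0) +
      (if u = b then (if v = a then q * F a b else 0) else 0) := by
    intro u v
    have h1 := hF u c
    have h2 := hF a b
    simp only [triangleStar, Sym2.eq_iff]
    split_ifs <;> grind
  have h1 : ∑ v, (if v ≠ c then x v * F c v else 0) =
      ∑ v ∈ Finset.univ.erase c, x v * F c v := by
    rw [← Finset.sum_filter]
    congr 1
    ext v
    simp
  simp only [h, Finset.sum_add_distrib, ← h1]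
  rw [Finset.sum_comm (f := fun u v => if v = c then (if u ≠ c then x u * F c u else 0) else 0)]
  simp only [Finset.sum_ite_irrel, Finset.sum_const_zero, Finset.sum_ite_eq', Finset.mem_univ,
    if_true]
  ring

open Classical in
theorem triangleStar_size (ha : a ≠ c) (hb : b ≠ c) (hab : a ≠ b) :
    (triangleStar c a b x q hx hq).size = ∑ v ∈ Finset.univ.erase c, x v + q := by
  have h := triangleStar_sum_μ_mul (hx := hx) (hq := hq) ha hb hab (fun _ _ => 1) fun _ _ => rfl
  have h2 := (triangleStar c a b x q hx hq).two_mul_size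
  simp only [mul_one] at h
  have h3 := h2.trans h
  linarith

-- Only an inequality is needed: the extra weight `q` in the degrees of `a` and `b` is dropped on
-- the spokes `ca` and `cb`.
open Classical in
theorem le_triangleStar_sombor (ha : a ≠ c) (hb : b ≠ c) (hab : a ≠ b) :
    ∑ v ∈ Finset.univ.erase c, x v * √((∑ w ∈ Finset.univ.erase c, x w) ^ 2 + x v ^ 2) +
      q * √((x a + q) ^ 2 + (x b + q) ^ 2) ≤ (triangleStar c a b x q hx hq).sombor := by
  set Γ := triangleStar c a b x q hx hq with hΓ
  have h : Γ.sombor = ∑ v ∈ Finset.univ.erase c, x v * √(Γ.degree c ^ 2 + Γ.degree v ^ 2) +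
      q * √(Γ.degree a ^ 2 + Γ.degree b ^ 2) := by
    have h1 := Γ.two_mul_sombor
    rw [hΓ, triangleStar_sum_μ_mul ha hb hab _ fun u v => by rw [add_comm]] at h1
    exact mul_left_cancel₀ two_ne_zero h1
  have hc : Γ.degree c = ∑ w ∈ Finset.univ.erase c, x w := by
    rw [degree, ← Finset.add_sum_erase _ _ (Finset.mem_univ c), Γ.μ_self, zero_add]
    exact Finset.sum_congr rfl fun v hv => triangleStar_μ_center (Finset.ne_of_mem_erase hv)
  have hv : ∀ v, v ≠ c → Γ.μ v c = x v := fun v hv =>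
    (Γ.μ_symm v c).trans (triangleStar_μ_center hv)
  have hd : ∀ v, v ≠ c → x v ≤ Γ.degree v := fun v hvc => hv v hvc ▸ Γ.μ_le_degree v c
  have hbase : ∀ u v, u ≠ c → v ≠ c → Γ.μ u v = q → x u + q ≤ Γ.degree u := by
    intro u v hu hvc h
    rw [← h, ← hv u hu, ← Finset.sum_pair (f := fun y => Γ.μ u y) hvc.symm]
    exact Finset.sum_le_sum_of_subset_of_nonneg (Finset.subset_univ _)
      fun y _ _ => Γ.μ_nonneg u y
  have hab' : Γ.μ a b = q := triangleStar_μ_base ha hb hab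
  have h3 := hbase a b ha hb hab'
  have h4 := hbase b a hb ha (Γ.μ_symm a b ▸ hab')
  have hxp := fun v => (hx v).1
  have hqp := hq.1
  have := hxp a
  have := hxp b
  rw [h, hc]
  refine add_le_add (Finset.sum_le_sum fun v hv => ?_) ?_
  · have := hd v (Finset.ne_of_mem_erase hv)
    have := hxp v
    gcongr
  · gcongr

end

/-! ### Concentrating the weights -/

/-- Distributing the least weight over the other ones increases the sum of the convex function
`t ↦ t * √(m ^ 2 + t ^ 2)`. -/
theorem exists_concentration {ι : Type*} [DecidableEq ι] (s : Finset ι) (w : ι → ℝ) (m : ℝ)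
    (hw : ∀ i ∈ s, w i ∈ Set.Ioc (0 : ℝ) 1) {i₀ : ι} (hi₀ : i₀ ∈ s) (hmin : ∀ i ∈ s, w i₀ ≤ w i)
    (hsum : ∑ i ∈ s, w i ≤ s.card - 1) :
    ∃ w' : ι → ℝ, (∀ i ∈ s.erase i₀, w' i ∈ Set.Ioc (0 : ℝ) 1) ∧
      ∑ i ∈ s.erase i₀, w' i = ∑ i ∈ s, w i ∧
      ∑ i ∈ s, w i * √(m ^ 2 + w i ^ 2) < ∑ i ∈ s.erase i₀, w' i * √(m ^ 2 + w' i ^ 2) := by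
  set ε := w i₀
  have hε : 0 < ε := (hw i₀ hi₀).1
  -- `D` is the room left below the cap 1. The bound on the total says that `ε` fits into it, so
  -- each weight receives a share of `ε` proportional to its own room.
  set D := ∑ i ∈ s.erase i₀, (1 - w i) with hDdef
  have hcard : ((s.erase i₀).card : ℝ) = s.card - 1 := by
    rw [← Finset.card_erase_add_one hi₀]
    push_cast
    ring
  have hsplit : ∑ i ∈ s, w i = ε + ∑ i ∈ s.erase i₀, w i := (Finset.add_sum_erase s w hi₀).symm
  have hD : ε ≤ D := by
    rw [hDdef, Finset.sum_sub_distrib, Finset.sum_const, nsmul_eq_mul, mul_one, hcard]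
    linarith
  have hD0 : 0 < D := hε.trans_le hD
  have hr : ε / D ≤ 1 := (div_le_one hD0).2 hD
  have hr0 : 0 < ε / D := div_pos hε hD0
  set t : ι → ℝ := fun i => ε / D * (1 - w i) with ht
  have htsum : ∑ i ∈ s.erase i₀, t i = ε := by
    rw [ht, ← Finset.mul_sum, ← hDdef, div_mul_cancel₀ _ hD0.ne']
  have hmem : ∀ i ∈ s.erase i₀, 0 < w i ∧ w i ≤ 1 ∧ ε ≤ w i := fun i hi =>
    ⟨(hw i (Finset.mem_of_mem_erase hi)).1, (hw i (Finset.mem_of_mem_erase hi)).2,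
      hmin i (Finset.mem_of_mem_erase hi)⟩
  have ht0 : ∀ i ∈ s.erase i₀, 0 ≤ t i := fun i hi =>
    mul_nonneg hr0.le (by linarith [(hmem i hi).2.1])
  have ht1 : ∀ i ∈ s.erase i₀, w i + t i ≤ 1 := fun i hi => by
    have : t i ≤ 1 * (1 - w i) := mul_le_mul_of_nonneg_right hr (by linarith [(hmem i hi).2.1])
    linarith
  refine ⟨fun i => w i + t i, fun i hi => ⟨by linarith [(hmem i hi).1, ht0 i hi], ht1 i hi⟩,
    by rw [Finset.sum_add_distrib, htsum, hsplit, add_comm], ?_⟩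
  -- Both `w i` and `ε` are at most `w i + t i`, so monotonicity of the square root suffices.
  have hstep : ∀ i ∈ s.erase i₀, w i * √(m ^ 2 + w i ^ 2) + t i * √(m ^ 2 + ε ^ 2) ≤
      (w i + t i) * √(m ^ 2 + (w i + t i) ^ 2) := by
    intro i hi
    obtain ⟨h1, h2, h3⟩ := hmem i hi
    have h4 := ht0 i hi
    rw [add_mul]
    have h5 : w i ≤ w i + t i := by linarith
    have h6 : ε ≤ w i + t i := by linarith
    gcongr
  have hlt : ∃ i ∈ s.erase i₀, w i * √(m ^ 2 + w i ^ 2) + t i * √(m ^ 2 + ε ^ 2) <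
      (w i + t i) * √(m ^ 2 + (w i + t i) ^ 2) := by
    obtain ⟨i, hi, hpos⟩ := Finset.exists_lt_of_sum_lt (s := s.erase i₀) (f := fun _ => (0 : ℝ))
      (g := t) (by rw [Finset.sum_const_zero, htsum]; exact hε)
    refine ⟨i, hi, ?_⟩
    obtain ⟨h1, h2, h3⟩ := hmem i hi
    rw [add_mul]
    have h5 : w i < w i + t i := by linarith
    have h6 : ε < w i + t i := by linarith
    gcongr
  have := Finset.sum_lt_sum hstep hlt
  rw [Finset.sum_add_distrib, ← Finset.sum_mul, htsum] at this
  rw [← Finset.add_sum_erase s _ hi₀]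
  linarith

variable [Fintype V]

/-- Both degrees lie between `μ(uv)` and `m`, and their sum is at most `m + μ(uv)`; by convexity the
extreme case is the pair `m`, `μ(uv)`. -/
theorem degree_sq_add_degree_sq_le (Γ : FuzzyGraph V) {u v : V} (huv : u ≠ v) :
    Γ.degree u ^ 2 + Γ.degree v ^ 2 ≤ Γ.size ^ 2 + Γ.μ u v ^ 2 := by
  have h1 := Γ.degree_add_degree_le huv
  have h2 := Γ.degree_le_size u
  have h3 := Γ.degree_le_size v
  have h4 := Γ.μ_le_degree u v
  have h5 := Γ.μ_le_degree v u
  have h6 := Γ.μ_nonneg u v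
  rw [Γ.μ_symm v u] at h5
  nlinarith [mul_nonneg (sub_nonneg.2 h2) (sub_nonneg.2 h4)]

open Classical in
theorem sombor_le_sum (Γ : FuzzyGraph V) :
    Γ.sombor ≤ ∑ e ∈ Γ.graph.edgeFinset,
      Γ.edgeMembership e * √(Γ.size ^ 2 + Γ.edgeMembership e ^ 2) := by
  refine Finset.sum_le_sum fun e he => ?_
  rw [SimpleGraph.mem_edgeFinset] at he
  induction e with
  | h u v =>
    exact mul_le_mul_of_nonneg_left
      (Real.sqrt_le_sqrt (Γ.degree_sq_add_degree_sq_le (Γ.graph.ne_of_adj he))) (Γ.μ_nonneg u v)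

theorem sombor_nonneg (Γ : FuzzyGraph V) : 0 ≤ Γ.sombor := by
  have h : 0 ≤ 2 * Γ.sombor := by
    rw [two_mul_sombor]
    exact Finset.sum_nonneg fun u _ => Finset.sum_nonneg fun v _ =>
      mul_nonneg (Γ.μ_nonneg u v) (Real.sqrt_nonneg _)
  linarith

-- After concentration `n - 1` edges carry weight, as many as there are spokes at `c`, so the
-- weights can be transported by any bijection.
open Classical in
theorem exists_spokes (Γ : FuzzyGraph V) (hΓ : Γ.IsUnicyclic) (c : V)
    (hsize : Γ.size ≤ Fintype.card V - 1) :
    ∃ x : V → ℝ, (∀ v, x v ∈ Set.Ioc (0 : ℝ) 1) ∧ ∑ v ∈ Finset.univ.erase c, x v = Γ.size ∧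
      Γ.sombor < ∑ v ∈ Finset.univ.erase c, x v * √(Γ.size ^ 2 + x v ^ 2) := by
  have hcard := Γ.card_edgeFinset hΓ
  have hne : Γ.graph.edgeFinset.Nonempty := by
    rw [← Finset.card_pos, hcard]
    exact Fintype.card_pos_iff.2 ⟨c⟩
  obtain ⟨e₀, he₀, hmin⟩ := Finset.exists_min_image _ Γ.edgeMembership hne
  obtain ⟨w, hw, hwsum, hwlt⟩ := exists_concentration _ Γ.edgeMembership Γ.size
    (fun e he => ⟨Γ.edgeMembership_pos (SimpleGraph.mem_edgeFinset.1 he),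
      Γ.edgeMembership_le_one e⟩) he₀ hmin (by rw [hcard]; exact hsize)
  have hc : (Finset.univ.erase c).card = (Γ.graph.edgeFinset.erase e₀).card := by
    rw [Finset.card_erase_of_mem (Finset.mem_univ c), Finset.card_erase_of_mem he₀, hcard,
      Finset.card_univ]
  let φ := Finset.equivOfCardEq hc
  -- The value 1 at `c` is a dummy that satisfies the range condition.
  let x : V → ℝ := fun v => if h : v ∈ Finset.univ.erase c then w (φ ⟨v, h⟩) else 1
  have hx : ∀ g : ℝ → ℝ, ∑ v ∈ Finset.univ.erase c, g (x v) =
      ∑ e ∈ Γ.graph.edgeFinset.erase e₀, g (w e) := by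
    intro g
    rw [← Finset.sum_coe_sort, ← Finset.sum_coe_sort (Γ.graph.edgeFinset.erase e₀),
      ← φ.sum_comp]
    refine Finset.sum_congr rfl fun v _ => ?_
    simp only [x, dif_pos v.2]
  refine ⟨x, fun v => ?_, (hx id).trans hwsum, Γ.sombor_le_sum.trans_lt ?_⟩
  · by_cases h : v ∈ Finset.univ.erase c
    · simp only [x, dif_pos h]
      exact hw _ (φ ⟨v, h⟩).2
    · simp only [x, dif_neg h]
      exact ⟨zero_lt_one, le_rfl⟩
  · rwa [hx fun t => t * √(Γ.size ^ 2 + t ^ 2)]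

theorem exists_triangle (hn : 3 ≤ Fintype.card V) : ∃ c a b : V, a ≠ c ∧ b ≠ c ∧ a ≠ b := by
  obtain ⟨c, a, b, h1, h2, h3⟩ := Fintype.two_lt_card_iff.1 hn
  exact ⟨c, a, b, h1.symm, h2.symm, h3⟩

/-- If the size is at most `n - 1`, every unicyclic fuzzy graph is beaten by a triangle with a
star attached. -/
theorem exists_sombor_lt_of_size_le (Γ : FuzzyGraph V) (hΓ : Γ.IsUnicyclic)
    (hn : 3 ≤ Fintype.card V) (hpos : 0 < Γ.size) (hsize : Γ.size ≤ Fintype.card V - 1) :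
    ∃ Γ' : FuzzyGraph V, Γ'.IsUnicyclic ∧ Γ'.size = Γ.size ∧ Γ'.graph.IsCycleWithStar 3 ∧
      Γ.sombor < Γ'.sombor := by
  classical
  obtain ⟨c, a, b, ha, hb, hab⟩ := exists_triangle hn
  obtain ⟨x, hx, hxsum, hlt⟩ := Γ.exists_spokes hΓ c hsize
  set m := Γ.size
  set K := ∑ v ∈ Finset.univ.erase c, x v * √(m ^ 2 + x v ^ 2) with hK
  have hs := Γ.sombor_nonneg
  have hK0 : 0 < K := hs.trans_lt hlt
  -- The first bound gives `δ < 1` and `δ * m ≤ 1`; the second makes the loss `K - (1 - δ)² * K ≤ 2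
  -- * δ * K` smaller than the gap `K - Γ.sombor`.
  set δ := min (1 / (m + 1)) ((K - Γ.sombor) / (4 * K)) with hδ
  have hδ0 : 0 < δ := lt_min (by positivity) (div_pos (by linarith) (by positivity))
  have hδ1 : δ * (m + 1) ≤ 1 := (le_div_iff₀ (by positivity)).1 (min_le_left _ _)
  have hδ2 : δ * (4 * K) ≤ K - Γ.sombor := (le_div_iff₀ (by positivity)).1 (min_le_right _ _)
  have hδm : 0 < δ * m := mul_pos hδ0 hpos
  have hδ' : δ < 1 := by linarith
  have hx' : ∀ v, (1 - δ) * x v ∈ Set.Ioc (0 : ℝ) 1 := fun v =>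
    ⟨mul_pos (by linarith) (hx v).1, mul_le_one₀ (by linarith) (hx v).1.le (hx v).2⟩
  have hq : δ * m ∈ Set.Ioc (0 : ℝ) 1 := ⟨hδm, by linarith⟩
  refine ⟨triangleStar c a b (fun v => (1 - δ) * x v) (δ * m) hx' hq,
    triangleStar_isUnicyclic ha hb hab, ?_, triangleStar_isCycleWithStar ha hb hab, ?_⟩
  · rw [triangleStar_size ha hb hab, ← Finset.mul_sum, hxsum]
    ring
  · refine lt_of_lt_of_le ?_ (le_triangleStar_sombor ha hb hab)
    have h1 : ∀ v, (1 - δ) * x v * √(((1 - δ) * m) ^ 2 + ((1 - δ) * x v) ^ 2) =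
        (1 - δ) ^ 2 * (x v * √(m ^ 2 + x v ^ 2)) := by
      intro v
      rw [mul_pow, mul_pow, ← mul_add, Real.sqrt_mul (sq_nonneg _),
        Real.sqrt_sq (by linarith)]
      ring
    rw [← Finset.mul_sum, hxsum, Finset.sum_congr rfl fun v _ => h1 v, ← Finset.mul_sum, ← hK]
    have h2 : 0 ≤ δ * m * √(((1 - δ) * x a + δ * m) ^ 2 + ((1 - δ) * x b + δ * m) ^ 2) :=
      mul_nonneg hδm.le (Real.sqrt_nonneg _)
    have h3 : 0 ≤ δ ^ 2 * K := by positivity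
    have h4 : 0 < δ * K := by positivity
    nlinarith

end FuzzyGraph

namespace FuzzyGraph

/-! ### Sizes larger than `n - 1` -/

theorem sq_add_sq_le_of_add_le {A B x y : ℝ} (hx : 0 ≤ x) (hy : 0 ≤ y) (hxA : x ≤ A) (hyA : y ≤ A)
    (hB : 0 ≤ B) (hxy : x + y ≤ A + B) : x ^ 2 + y ^ 2 ≤ A ^ 2 + B ^ 2 := by
  rcases le_total (x + y) A with h | h
  · nlinarith [mul_nonneg hx hy]
  · nlinarith [mul_nonneg (sub_nonneg.2 hxA) (sub_nonneg.2 hyA)]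

/-- Here `A = n - 2`. With `r = 1 / A`, the roots are replaced by `√(A² + 4) ≤ A + 2r` and by a
bound on their difference from `C² - D² = 4ε + ε²` and `C + D ≥ 2A`, leaving a polynomial
inequality. -/
theorem somborBound_lt_of_three_le {A ε : ℝ} (hA : 3 ≤ A) (hε0 : 0 ≤ ε) (hε1 : ε ≤ 1) :
    (A + 1 + ε) * √(A ^ 2 + 2 ^ 2) + (√(A ^ 2 + (2 + ε) ^ 2) - √(A ^ 2 + 2 ^ 2)) <
      (A + 1) * √((A + 1) ^ 2 + 1) + ε * (√2 * (1 + ε)) := by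
  have hA0 : 0 < A := by linarith
  obtain ⟨r, hr⟩ : ∃ r, r * A = 1 := ⟨A⁻¹, inv_mul_cancel₀ hA0.ne'⟩
  have hr0 : 0 < r := by
    by_contra! h
    nlinarith
  have hr3 : r ≤ 1 / 3 := by nlinarith
  have h2 : (1.41 : ℝ) ≤ √2 := Real.le_sqrt_of_sq_le (by norm_num)
  have hQ : (A + 1) ^ 2 + 2 / 5 ≤ (A + 1) * √((A + 1) ^ 2 + 1) := by
    rw [← Real.sqrt_sq (by linarith : 0 ≤ A + 1), ← Real.sqrt_mul (sq_nonneg _),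
      Real.sq_sqrt (sq_nonneg _)]
    apply Real.le_sqrt_of_sq_le
    nlinarith
  have hD : √(A ^ 2 + 2 ^ 2) ≤ A + 2 * r := by
    refine Real.sqrt_le_iff.2 ⟨by positivity, ?_⟩
    nlinarith
  have hDA : A ≤ √(A ^ 2 + 2 ^ 2) := Real.le_sqrt_of_sq_le (by norm_num)
  have hCD : √(A ^ 2 + 2 ^ 2) ≤ √(A ^ 2 + (2 + ε) ^ 2) := by
    gcongr
    linarith
  have hD2 := Real.sq_sqrt (by positivity : 0 ≤ A ^ 2 + 2 ^ 2)
  have hC2 := Real.sq_sqrt (by positivity : 0 ≤ A ^ 2 + (2 + ε) ^ 2)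
  set D := √(A ^ 2 + 2 ^ 2)
  set C := √(A ^ 2 + (2 + ε) ^ 2)
  have hdiff : C - D ≤ (4 * ε + ε ^ 2) / 2 * r := by
    have h1 : (C - D) * (2 * A) ≤ 4 * ε + ε ^ 2 := by
      nlinarith [mul_nonneg (sub_nonneg.2 hCD) (by linarith : 0 ≤ C + D - 2 * A)]
    calc C - D = (C - D) * (2 * A) * (r / 2) := by linear_combination -(C - D) * hr
      _ ≤ (4 * ε + ε ^ 2) * (r / 2) := by gcongr
      _ = _ := by ring
  have h3 : (A + 1 + ε) * D ≤ (A + 1 + ε) * (A + 2 * r) := by gcongr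
  have h4 : ε * (1.41 * (1 + ε)) ≤ ε * (√2 * (1 + ε)) := by gcongr
  have h5 : 0 ≤ (1 - ε) * (A - 3) := mul_nonneg (by linarith) (by linarith)
  have h6 : 0 ≤ (1 / 3 - r) * (2 + 4 * ε + ε ^ 2 / 2) :=
    mul_nonneg (by linarith) (by positivity)
  have h7 : 0 ≤ (1 - ε) * (1 - ε) := mul_self_nonneg _
  nlinarith

/-- For `A ≤ 2` the bound `√2 * A` from the degrees alone is no worse than `√(A² + 2²)`. -/
theorem somborBound_lt_of_le_two {A ε : ℝ} (hA : A = 1 ∨ A = 2) (hε0 : 0 ≤ ε) :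
    (A + 1 + ε) * (√2 * A) < (A + 1) * √((A + 1) ^ 2 + 1) + ε * (√2 * (1 + ε)) := by
  have h1 : (1.41 : ℝ) ≤ √2 := Real.le_sqrt_of_sq_le (by norm_num)
  have h2 : √2 ≤ 1.42 := Real.sqrt_le_iff.2 ⟨by norm_num, by norm_num⟩
  rcases hA with rfl | rfl
  · have h3 : (2.2 : ℝ) ≤ √((1 + 1) ^ 2 + 1) := Real.le_sqrt_of_sq_le (by norm_num)
    generalize √2 = s at *
    generalize √((1 + 1) ^ 2 + 1) = Q at *
    nlinarith [mul_nonneg hε0 hε0, mul_nonneg (mul_nonneg hε0 hε0) (by linarith : 0 ≤ s)]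
  · have h3 : (3.15 : ℝ) ≤ √((2 + 1) ^ 2 + 1) := Real.le_sqrt_of_sq_le (by norm_num)
    generalize √2 = s at *
    generalize √((2 + 1) ^ 2 + 1) = Q at *
    -- The difference contains `√2 * (ε - ε²)`, and `ε - ε² ≤ 1 / 4`.
    nlinarith [mul_nonneg (sq_nonneg (ε - 1 / 2)) (by linarith : 0 ≤ s)]

variable {V : Type*} [Fintype V]

open Classical in
theorem size_le_sum_add (Γ : FuzzyGraph V) (hΓ : Γ.IsUnicyclic) {F : Finset (Sym2 V)}
    (hF : F ⊆ Γ.graph.edgeFinset) :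
    Γ.size + F.card ≤ ∑ e ∈ F, Γ.edgeMembership e + Fintype.card V := by
  have h1 : Γ.size = ∑ e ∈ Γ.graph.edgeFinset \ F, Γ.edgeMembership e +
      ∑ e ∈ F, Γ.edgeMembership e := (Finset.sum_sdiff hF).symm
  have h2 : ∑ e ∈ Γ.graph.edgeFinset \ F, Γ.edgeMembership e ≤
      (Γ.graph.edgeFinset \ F).card := by
    refine (Finset.sum_le_card_nsmul _ _ 1 fun e _ => Γ.edgeMembership_le_one e).trans_eq ?_
    rw [nsmul_eq_mul, mul_one]
  have h3 := Finset.card_sdiff_add_card_eq_card hF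
  rw [Γ.card_edgeFinset hΓ] at h3
  have h4 : ((Γ.graph.edgeFinset \ F).card : ℝ) + F.card = Fintype.card V := by
    exact_mod_cast h3
  linarith

theorem size_add_one_le (Γ : FuzzyGraph V) (hΓ : Γ.IsUnicyclic) {e : Sym2 V}
    (he : e ∈ Γ.graph.edgeSet) : Γ.size + 1 ≤ Γ.edgeMembership e + Fintype.card V := by
  classical
  simpa using Γ.size_le_sum_add hΓ (F := {e}) (by simpa using he)

/-- Two edges `e`, `f` miss `u`. Their weights cancel between the bound for the degree of `u` and
the bound by 1 on each of the other `n - 2` edges. -/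
theorem degree_add_two_le (Γ : FuzzyGraph V) (hΓ : Γ.IsUnicyclic)
    (hstar : ¬ Γ.graph.IsCycleWithStar 3) (u : V) : Γ.degree u + 2 ≤ Fintype.card V := by
  classical
  obtain ⟨e, he, f, hf, hue, huf, hef⟩ : ∃ e ∈ Γ.graph.edgeSet, ∃ f ∈ Γ.graph.edgeSet,
      u ∉ e ∧ u ∉ f ∧ e ≠ f := by
    by_contra! h
    exact hstar (SimpleGraph.isCycleWithStar_three_of_pairwise
      (SimpleGraph.IsConnectedUnicyclic.ncard_edgeSet hΓ) h)
  have hF : ({e, f} : Finset (Sym2 V)) ⊆ Γ.graph.edgeFinset := by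
    intro g hg
    rw [SimpleGraph.mem_edgeFinset]
    rcases Finset.mem_insert.1 hg with rfl | hg
    · exact he
    · exact Finset.mem_singleton.1 hg ▸ hf
  have h1 := Γ.size_le_sum_add hΓ hF
  have h2 := Γ.degree_add_sum_le_size (u := u) hF (by
    intro g hg
    rcases Finset.mem_insert.1 hg with rfl | hg
    · exact hue
    · exact Finset.mem_singleton.1 hg ▸ huf)
  rw [Finset.card_pair hef] at h1
  push_cast at h1
  linarith

theorem degree_add_degree_le_card (Γ : FuzzyGraph V) (hΓ : Γ.IsUnicyclic) {u v : V}
    (huv : u ≠ v) {g : Sym2 V} (hg : g ∈ Γ.graph.edgeSet) (hu : u ∉ g) (hv : v ∉ g) :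
    Γ.degree u + Γ.degree v ≤ Fintype.card V := by
  classical
  have h1 := Γ.size_add_one_le hΓ hg
  have h2 := Γ.degree_add_degree_add_sum_le huv (F := {g}) (by simpa using hg) (by simpa using hu)
    (by simpa using hv)
  rw [Finset.sum_singleton] at h2
  linarith [Γ.μ_le_one u v]

-- An edge disjoint from some other edge has end degrees summing to at most `n = A + 2`, hence the
-- factor `√(A² + 2²)`. At most one edge meets all others; its degree sum is at most `m + 1 = A + (2
-- + ε)`, and its weight is at most 1, so the correction is paid once.
open Classical in
theorem sombor_le_of_not_isCycleWithStar (Γ : FuzzyGraph V) (hΓ : Γ.IsUnicyclic)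
    (hstar : ¬ Γ.graph.IsCycleWithStar 3) {A ε : ℝ} (hA : A + 2 = Fintype.card V)
    (hε : Γ.size = A + 1 + ε) (hε0 : 0 ≤ ε) :
    Γ.sombor ≤ Γ.size * √(A ^ 2 + 2 ^ 2) + (√(A ^ 2 + (2 + ε) ^ 2) - √(A ^ 2 + 2 ^ 2)) := by
  have hd : ∀ u, Γ.degree u ≤ A := fun u => by linarith [Γ.degree_add_two_le hΓ hstar u]
  have hCD : √(A ^ 2 + 2 ^ 2) ≤ √(A ^ 2 + (2 + ε) ^ 2) := by
    gcongr
    linarith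
  set D := √(A ^ 2 + 2 ^ 2)
  set C := √(A ^ 2 + (2 + ε) ^ 2)
  have hmem : ∀ {e}, e ∈ Γ.graph.edgeFinset → e ∈ Γ.graph.edgeSet :=
    fun h => SimpleGraph.mem_edgeFinset.1 h
  have hnon : ∀ e ∈ Γ.graph.edgeFinset, (∃ g ∈ Γ.graph.edgeSet, ∀ x ∈ e, x ∉ g) →
      Γ.somborTerm e ≤ Γ.edgeMembership e * D := by
    rintro e he ⟨g, hg, hdisj⟩
    induction e with
    | h u v =>
      refine mul_le_mul_of_nonneg_left (Real.sqrt_le_sqrt ?_) (Γ.μ_nonneg u v)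
      have := Γ.degree_add_degree_le_card hΓ (Γ.graph.ne_of_adj (hmem he)) hg
        (hdisj u (Sym2.mem_mk_left u v)) (hdisj v (Sym2.mem_mk_right u v))
      exact sq_add_sq_le_of_add_le (Γ.degree_nonneg u) (Γ.degree_nonneg v) (hd u) (hd v)
        zero_le_two (by linarith)
  have hall : ∀ e ∈ Γ.graph.edgeFinset, Γ.somborTerm e ≤ Γ.edgeMembership e * C := by
    rintro e he
    induction e with
    | h u v =>
      refine mul_le_mul_of_nonneg_left (Real.sqrt_le_sqrt ?_) (Γ.μ_nonneg u v)
      have := Γ.degree_add_degree_le (Γ.graph.ne_of_adj (hmem he))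
      exact sq_add_sq_le_of_add_le (Γ.degree_nonneg u) (Γ.degree_nonneg v) (hd u) (hd v)
        (by linarith) (by linarith [Γ.μ_le_one u v])
  by_cases hdom : ∃ e ∈ Γ.graph.edgeFinset, ∀ g ∈ Γ.graph.edgeSet, ∃ x ∈ e, x ∈ g
  · obtain ⟨e, he, hde⟩ := hdom
    have h1 : ∑ f ∈ Γ.graph.edgeFinset.erase e, Γ.somborTerm f ≤
        ∑ f ∈ Γ.graph.edgeFinset.erase e, Γ.edgeMembership f * D := by
      refine Finset.sum_le_sum fun f hf => ?_
      obtain ⟨hfe, hf⟩ := Finset.mem_erase.1 hf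
      refine hnon f hf ?_
      by_contra! hdf
      exact hstar (SimpleGraph.isCycleWithStar_three_of_two_dominating
        (SimpleGraph.IsConnectedUnicyclic.ncard_edgeSet hΓ) (hmem he) (hmem hf) hfe.symm hde hdf)
    rw [← Finset.sum_mul] at h1
    have h2 : Γ.sombor = Γ.somborTerm e + ∑ f ∈ Γ.graph.edgeFinset.erase e, Γ.somborTerm f :=
      (Finset.add_sum_erase _ _ he).symm
    have h3 : Γ.size = Γ.edgeMembership e +
        ∑ f ∈ Γ.graph.edgeFinset.erase e, Γ.edgeMembership f :=
      (Finset.add_sum_erase _ _ he).symm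
    have h4 := mul_le_mul_of_nonneg_right (Γ.edgeMembership_le_one e) (sub_nonneg.2 hCD)
    have h5 := hall e he
    rw [h2, h3]
    linarith
  · push Not at hdom
    have h1 : Γ.sombor ≤ ∑ e ∈ Γ.graph.edgeFinset, Γ.edgeMembership e * D :=
      Finset.sum_le_sum fun e he => hnon e he (hdom e he)
    rw [← Finset.sum_mul] at h1
    have h2 : Γ.sombor ≤ Γ.size * D := h1
    linarith

theorem sombor_le_of_degree_le (Γ : FuzzyGraph V) {A : ℝ} (hA : 0 ≤ A)
    (hd : ∀ u, Γ.degree u ≤ A) : Γ.sombor ≤ Γ.size * (√2 * A) := by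
  classical
  refine (Finset.sum_le_sum (g := fun e => Γ.edgeMembership e * (√2 * A)) fun e _ => ?_).trans_eq
    (Finset.sum_mul _ _ _).symm
  induction e with
  | h u v =>
    refine mul_le_mul_of_nonneg_left ?_ (Γ.μ_nonneg u v)
    rw [← Real.sqrt_sq hA, ← Real.sqrt_mul zero_le_two]
    have := pow_le_pow_left₀ (Γ.degree_nonneg u) (hd u) 2
    have := pow_le_pow_left₀ (Γ.degree_nonneg v) (hd v) 2
    exact Real.sqrt_le_sqrt (by linarith)

/-- If the size exceeds `n - 1`, some triangle with a star attached beats every unicyclic fuzzy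
graph of another shape. -/
theorem exists_forall_sombor_lt (hn : 3 ≤ Fintype.card V) {m : ℝ}
    (hm : (Fintype.card V : ℝ) - 1 < m) (hmn : m ≤ Fintype.card V) :
    ∃ Γ' : FuzzyGraph V, Γ'.IsUnicyclic ∧ Γ'.size = m ∧ Γ'.graph.IsCycleWithStar 3 ∧
      ∀ Γ : FuzzyGraph V, Γ.IsUnicyclic → Γ.size = m → ¬ Γ.graph.IsCycleWithStar 3 →
        Γ.sombor < Γ'.sombor := by
  classical
  obtain ⟨c, a, b, ha, hb, hab⟩ := exists_triangle hn
  obtain ⟨A, hA⟩ : ∃ A : ℝ, A + 2 = Fintype.card V := ⟨Fintype.card V - 2, by ring⟩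
  obtain ⟨ε, hε⟩ : ∃ ε : ℝ, m = A + 1 + ε := ⟨m - A - 1, by ring⟩
  have hε0 : 0 < ε := by linarith
  have hε1 : ε ≤ 1 := by linarith
  have hx : ∀ v : V, (fun _ => (1 : ℝ)) v ∈ Set.Ioc (0 : ℝ) 1 := fun _ => ⟨zero_lt_one, le_rfl⟩
  have hsum : ∑ v ∈ Finset.univ.erase c, (1 : ℝ) = A + 1 := by
    rw [Finset.sum_const, nsmul_eq_mul, mul_one, Finset.card_erase_of_mem (Finset.mem_univ c),
      Finset.card_univ, Nat.cast_sub (by omega), ← hA]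
    push_cast
    ring
  have hq : ε ∈ Set.Ioc (0 : ℝ) 1 := ⟨hε0, hε1⟩
  have hbound := le_triangleStar_sombor (x := fun _ => (1 : ℝ)) (hx := hx) (hq := hq)
    ha hb hab
  refine ⟨triangleStar c a b (fun _ => 1) ε hx hq, triangleStar_isUnicyclic ha hb hab, ?_,
    triangleStar_isCycleWithStar ha hb hab, fun Γ hΓ hsize hstar => lt_of_lt_of_le ?_ hbound⟩
  · rw [triangleStar_size ha hb hab, hsum, hε]
  · rw [hsum, ← Finset.sum_mul, hsum, ← two_mul, Real.sqrt_mul zero_le_two,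
      Real.sqrt_sq (by linarith), one_pow]
    rw [hε] at hsize
    by_cases h5 : 5 ≤ Fintype.card V
    · have h5' : (5 : ℝ) ≤ Fintype.card V := by exact_mod_cast h5
      have h := Γ.sombor_le_of_not_isCycleWithStar hΓ hstar hA hsize hε0.le
      rw [hsize] at h
      exact h.trans_lt (somborBound_lt_of_three_le (by linarith) hε0.le hε1)
    · have hA12 : A = 1 ∨ A = 2 := by
        rcases (by omega : Fintype.card V = 3 ∨ Fintype.card V = 4) with h | h
        · rw [h] at hA
          left
          push_cast at hA
          linarith
        · rw [h] at hA
          right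
          push_cast at hA
          linarith
      have h := Γ.sombor_le_of_degree_le (A := A) (by rcases hA12 with rfl | rfl <;> norm_num)
        fun u => by linarith [Γ.degree_add_two_le hΓ hstar u]
      rw [hsize] at h
      exact h.trans_lt (somborBound_lt_of_le_two hA12 hε0.le)

/-! ### Existence of a maximiser by compactness. -/

theorem exists_isMaximal (hn : 3 ≤ Fintype.card V) {m : ℝ}
    (hm : (Fintype.card V : ℝ) - 1 < m) (hmn : m ≤ Fintype.card V) :
    ∃ Γ₁ : FuzzyGraph V, Γ₁.IsUnicyclic ∧ Γ₁.size = m ∧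
      ∀ Γ : FuzzyGraph V, Γ.IsUnicyclic → Γ.size = m → Γ.sombor ≤ Γ₁.sombor := by
  classical
  set ε := m - (Fintype.card V - 1) with hε
  have hε0 : 0 < ε := sub_pos.2 hm
  -- As the other `n - 1` edges weigh at most 1, each edge weighs at least `ε`. The closed range
  -- `[ε, 1]` thus loses no member, and no edge can vanish in a limit.
  let K : SimpleGraph V → Set (V → V → ℝ) := fun G =>
    (Set.univ.pi fun u => Set.univ.pi fun v => if G.Adj u v then Set.Icc ε 1 else {0}) ∩
      ({μ | ∀ u v, μ u v = μ v u} ∩ {μ | ∑ u, ∑ v, μ u v = 2 * m})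
  let S : Set (V → V → ℝ) := ⋃ G ∈ {G : SimpleGraph V | G.IsConnectedUnicyclic}, K G
  have hS : IsCompact S := by
    refine (Set.toFinite _).isCompact_biUnion fun G _ => IsCompact.inter_right ?_ (.inter ?_ ?_)
    · refine isCompact_univ_pi fun u => isCompact_univ_pi fun v => ?_
      split_ifs
      · exact isCompact_Icc
      · exact isCompact_singleton
    · simp only [Set.ofPred_forall]
      exact isClosed_iInter fun u => isClosed_iInter fun v =>
        isClosed_eq (by fun_prop) (by fun_prop)
    · exact isClosed_eq (by fun_prop) (by fun_prop)
  have hmem : ∀ Γ : FuzzyGraph V, Γ.IsUnicyclic → Γ.size = m → Γ.μ ∈ S := by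
    intro Γ hΓ hsize
    refine Set.mem_biUnion (show Γ.graph ∈ _ from hΓ) ⟨fun u _ v _ => ?_, Γ.μ_symm, ?_⟩
    · dsimp only
      split_ifs with h
      · have h1 : Γ.size + 1 ≤ Γ.μ u v + Fintype.card V := Γ.size_add_one_le hΓ (e := s(u, v)) h
        exact ⟨by linarith, Γ.μ_le_one u v⟩
      · exact Γ.μ_eq_zero h
    · rw [← hsize]
      exact Γ.two_mul_size.symm
  let f : (V → V → ℝ) → ℝ := fun μ =>
    ∑ u, ∑ v, μ u v * √((∑ w, μ u w) ^ 2 + (∑ w, μ v w) ^ 2)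
  have hf : Continuous f := by fun_prop
  obtain ⟨Γ', hΓ', hsize', -, -⟩ := exists_forall_sombor_lt hn hm hmn
  obtain ⟨μ, hμ, hmax⟩ := hS.exists_isMaxOn ⟨Γ'.μ, hmem Γ' hΓ' hsize'⟩ hf.continuousOn
  obtain ⟨G, hG, hbox, hsymm, hsum⟩ := Set.mem_iUnion₂.1 hμ
  have hadj : ∀ u v, G.Adj u v → μ u v ∈ Set.Icc ε 1 := fun u v h => by
    have : μ u v ∈ if G.Adj u v then Set.Icc ε 1 else {0} := hbox u trivial v trivial
    rwa [if_pos h] at this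
  have hnadj : ∀ u v, ¬ G.Adj u v → μ u v = 0 := fun u v h => by
    have : μ u v ∈ if G.Adj u v then Set.Icc ε 1 else {0} := hbox u trivial v trivial
    rw [if_neg h] at this
    exact this
  have h01 : ∀ u v, μ u v ∈ Set.Icc (0 : ℝ) 1 := fun u v => by
    by_cases h : G.Adj u v
    · exact ⟨hε0.le.trans (hadj u v h).1, (hadj u v h).2⟩
    · rw [hnadj u v h]
      exact ⟨le_rfl, zero_le_one⟩
  let Γ₁ : FuzzyGraph V :=
    { ν := fun _ => 1
      μ := μ
      ν_mem := fun _ => ⟨zero_le_one, le_rfl⟩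
      μ_mem := h01
      μ_symm := hsymm
      μ_self := fun v => hnadj v v (G.irrefl)
      μ_le := fun u v => by rw [min_self]; exact (h01 u v).2 }
  have hgraph : Γ₁.graph = G := by
    ext u v
    change 0 < μ u v ↔ _
    refine ⟨fun h => by_contra fun hn => h.ne' (hnadj u v hn), fun h => ?_⟩
    exact hε0.trans_le (hadj u v h).1
  refine ⟨Γ₁, ?_, ?_, fun Γ hΓ hsize => ?_⟩
  · rw [IsUnicyclic, hgraph]
    exact hG
  · have h1 : 2 * Γ₁.size = 2 * m := Γ₁.two_mul_size.trans hsum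
    linarith
  · have h1 : f Γ.μ ≤ f μ := hmax (hmem Γ hΓ hsize)
    have h2 : 2 * Γ.sombor = f Γ.μ := Γ.two_mul_sombor
    have h3 : 2 * Γ₁.sombor = f μ := Γ₁.two_mul_sombor
    linarith

end FuzzyGraph

/-! ### Assembling minimum, maximum and attainment. -/

theorem mainTheorem4 {V : Type*} [Fintype V] (hn : 3 ≤ Fintype.card V)
    (m : ℝ) (hm : 0 < m) (hmn : m ≤ Fintype.card V) :
    -- minimum: the uniform fuzzy cycle exists, is admissible, attains the minimum,
    -- and every minimiser is a fuzzy cycle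
    (∃ Γ₀ : FuzzyGraph V, Γ₀.IsUniformFuzzyCycle (m / Fintype.card V)) ∧
    (∀ Γ₀ : FuzzyGraph V, Γ₀.IsUniformFuzzyCycle (m / Fintype.card V) →
      Γ₀.IsUnicyclic ∧ Γ₀.size = m ∧
      ∀ Γ : FuzzyGraph V, Γ.IsUnicyclic → Γ.size = m →
        Γ₀.sombor ≤ Γ.sombor ∧ (Γ.sombor = Γ₀.sombor → Γ.IsFuzzyCycle)) ∧
    -- maximum: cycles (of length three) with a star attached dominate all others, strictly
    (∀ Γ : FuzzyGraph V, Γ.IsUnicyclic → Γ.size = m →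
      ∃ Γ' : FuzzyGraph V, Γ'.IsUnicyclic ∧ Γ'.size = m ∧ Γ'.graph.IsCycleWithStar 3 ∧
        Γ.sombor ≤ Γ'.sombor ∧ (¬ Γ.graph.IsCycleWithStar 3 → Γ.sombor < Γ'.sombor)) ∧
    -- a maximiser exists exactly when `m > n - 1`
    ((∃ Γ₁ : FuzzyGraph V, Γ₁.IsUnicyclic ∧ Γ₁.size = m ∧
        ∀ Γ : FuzzyGraph V, Γ.IsUnicyclic → Γ.size = m → Γ.sombor ≤ Γ₁.sombor) ↔
      (Fintype.card V : ℝ) - 1 < m) := by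
  have hn0 : (0 : ℝ) < Fintype.card V := by exact_mod_cast (by omega : 0 < Fintype.card V)
  refine ⟨FuzzyGraph.exists_isUniformFuzzyCycle (div_pos hm hn0) ((div_le_one hn0).2 hmn),
    fun Γ₀ h => ⟨h.1.isUnicyclic hn, ?_, fun Γ hΓ hsize => h.isMinimal hn hΓ hsize⟩,
    fun Γ hΓ hsize => ?_, ?_, fun h => FuzzyGraph.exists_isMaximal hn h hmn⟩
  · rw [h.size_eq hn, mul_div_cancel₀ _ hn0.ne']
  · by_cases hstar : Γ.graph.IsCycleWithStar 3
    · exact ⟨Γ, hΓ, hsize, hstar, le_rfl, fun h => absurd hstar h⟩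
    · rcases le_or_gt m (Fintype.card V - 1) with h | h
      · subst hsize
        obtain ⟨Γ', h1, h2, h3, h4⟩ := Γ.exists_sombor_lt_of_size_le hΓ hn hm h
        exact ⟨Γ', h1, h2, h3, h4.le, fun _ => h4⟩
      · obtain ⟨Γ', h1, h2, h3, h4⟩ := FuzzyGraph.exists_forall_sombor_lt hn h hmn
        exact ⟨Γ', h1, h2, h3, (h4 Γ hΓ hsize hstar).le, h4 Γ hΓ hsize⟩
  · rintro ⟨Γ₁, hΓ₁, rfl, hmax⟩
    by_contra! h
    obtain ⟨Γ', h1, h2, -, h4⟩ := Γ₁.exists_sombor_lt_of_size_le hΓ₁ hn hm h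
    exact absurd (hmax Γ' h1 h2) (not_le.2 h4)
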